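/- Let $\mathcal A$ be an abelian category with all small coproducts. **(I)** Let $\mathcal P$ be a (small) set of projective objects of $\mathcal A$, and let $\mathcal B=\mathcal P^{\perp}$ be the full subcategory of all $A\in\mathcal A$ with $\operatorname{Hom}(P,A)=0$ for every $P\in\mathcal P$; let $i_*:\mathcal B\to\mathcal A$ be the inclusion. A morphism $f:Y\to Z$ is a *$\mathcal P$-epimorphism* if $\operatorname{Hom}(P,f)$ is surjective for every $P\in\mathcal P$, and an object is *$\mathcal P$-projective* if every morphism from it to $Z$ lifts through every $\mathcal P$-epimorphism $Y\to Z$. 1. $\mathcal B$ contains the zero objects and is thick, i.e. closed under kernels, cokernels and extensions in $\mathcal A$; it is an abelian category, and $i_*$ is exact. 2. For $A\in\mathcal A$ put $\Phi(A)=\bigoplus_{f:P\to A}P$, the coproduct over all morphisms $f:P\to A$ with $P\in\mathcal P$, and let $\epsilon_A:\Phi(A)\to A$ be the morphism that restricts to $f$ on the summand indexed by $f$. Then $A\mapsto i^*(A)=\operatorname{Coker}(\epsilon_A)$ is a functor $i^*:\mathcal A\to\mathcal B$, left adjoint to $i_*$, and the unit of the adjunction is the projection $A\to\operatorname{Coker}(\epsilon_A)$.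 3. A *$\mathcal P$-projective resolution* of $A$ is a chain complex $X=(\cdots\to X_1\to X_0\to X_{-1}=A\to 0)$ with $X_n=0$ for $n<-1$, $X_n$ $\mathcal P$-projective for $n\ge 0$, and $\operatorname{Hom}(P,X)$ exact for all $P\in\mathcal P$. A *$\mathcal P$-projective resolution* of a bounded above cochain complex $K$ is a morphism of complexes $p:X\to K$ with $X$ bounded above, all $X^i$ $\mathcal P$-projective, and $\operatorname{Hom}(P,p)$ a quasi-isomorphism (equivalently, $\operatorname{Hom}(P,\operatorname{Cone}(p))$ exact) for all $P\in\mathcal P$. Every object of $\mathcal A$ and every bounded above complex has a $\mathcal P$-projective resolution in which the terms ($X_n$ with $n\ge0$, respectively all $X^i$) are coproducts of small families of objects of $\mathcal P$. 4. Let $\mathsf D^-(\mathcal A)$ be the bounded above derived category, $\mathsf D^-_{\mathcal B}(\mathcal A)$ its full subcategory of objects all of whose homology objects lie in $\mathcal B$, and $j_*:\mathsf D^-_{\mathcal B}(\mathcal A)\to\mathsf D^-(\mathcal A)$ the inclusion. There is a functor $j^*:\mathsf D^-(\mathcal A)\to\mathsf D^-_{\mathcal B}(\mathcal A)$, left adjoint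 to $j_*$, which is computed by resolutions as follows. - For every $A\in\mathcal A$, regarded as a complex in degree $0$, and every $\mathcal P$-projective resolution $X$ of $A$, regarded as a cochain complex with $X_{-1}=A$ in degree $0$ and $X_n$ in degree $-(n+1)$, the complex $X$ lies in $\mathsf D^-_{\mathcal B}(\mathcal A)$ and there is an isomorphism $j^*(A)\cong X$ carrying the unit $A\to j_*j^*(A)$ to the inclusion of the subcomplex $A\to X$. - For every bounded above complex $K$ and every $\mathcal P$-projective resolution $p:X\to K$, the complex $\operatorname{Cone}(p)$ lies in $\mathsf D^-_{\mathcal B}(\mathcal A)$ and there is an isomorphism $j^*(K)\cong\operatorname{Cone}(p)$ carrying the unit $K\to j_*j^*(K)$ to the canonical morphism $K\to\operatorname{Cone}(p)$. **(II)** Let $\cdots\subset\mathcal P_{n+1}\subset\mathcal P_n\subset\cdots\subset\mathcal P_1\subset\mathcal P_0$ be a descending sequence of sets of projective objects of $\mathcal A$, and write $\mathcal B_n=\mathcal P_n^{\perp}$, $i_{n*}$, $i_n^*$, $j_{n*}$, $j_n^*$ for the corresponding categories and functors (where $j_n^*$ is any left adjoint of $j_{n*}$). Then $\mathcal B_n\subset\mathcal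 B_{n+1}$ for all $n$. There are unique natural transformations $i_{n+1,*}i_{n+1}^*\to i_{n*}i_n^*$ with epimorphic components that are compatible with the units, and the units $A\to i_{n*}i_n^*(A)$ are epimorphisms, so that every $A\in\mathcal A$ has a natural tower of epimorphisms $$A\to\cdots\to i_{n+1,*}i_{n+1}^*(A)\to i_{n*}i_n^*(A)\to\cdots\to i_{0*}i_0^*(A).$$ There are unique natural transformations $j_{n+1,*}j_{n+1}^*\to j_{n*}j_n^*$ that are compatible with the units, so that every object $A$ of $\mathsf D^-(\mathcal A)$ (in particular every object of $\mathcal A$) has a natural tower of morphisms in $\mathsf D^-(\mathcal A)$ $$A\to\cdots\to j_{n+1,*}j_{n+1}^*(A)\to j_{n*}j_n^*(A)\to\cdots\to j_{0*}j_0^*(A).$$ -/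

import Mathlib

open CategoryTheory CategoryTheory.Limits

universe w v u

namespace RelativeProjective

noncomputable section

section Abelian

variable {C : Type u} [Category.{v} C] [Abelian C] [HasCoproducts.{v} C]

/-- The index set of `Φ(A)`: all morphisms `f : P ⟶ A` whose source belongs to `𝔓`. -/
abbrev PhiIndex (𝔓 : ObjectProperty C) (A : C) : Type max u v :=
  Σ P : Subtype 𝔓, (P.1 ⟶ A)

instance hasColimitsOfShape_phiIndex (𝔓 : ObjectProperty C) [ObjectProperty.Small.{v} 𝔓] (A : C) :
    HasColimitsOfShape (Discrete (PhiIndex 𝔓 A)) C :=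
  hasCoproductsOfShape_of_small C (PhiIndex 𝔓 A)

/-- `Φ(A)`, the coproduct of the objects `P` over all `f : P ⟶ A` with `P` in `𝔓`. -/
abbrev Phi (𝔓 : ObjectProperty C) [ObjectProperty.Small.{v} 𝔓] (A : C) : C :=
  ∐ fun x : PhiIndex 𝔓 A => x.1.1

/-- The standard inclusion `in_f : P ⟶ Φ(A)` of the summand indexed by `f : P ⟶ A`. -/
def phiIn (𝔓 : ObjectProperty C) [ObjectProperty.Small.{v} 𝔓] {A P : C} (hP : 𝔓 P) (f : P ⟶ A) :
    P ⟶ Phi 𝔓 A :=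
  Sigma.ι (fun x : PhiIndex 𝔓 A => x.1.1) ⟨⟨P, hP⟩, f⟩

/-- The morphism `ε_A : Φ(A) ⟶ A` with `in_f ≫ ε_A = f`. -/
def epsilon (𝔓 : ObjectProperty C) [ObjectProperty.Small.{v} 𝔓] (A : C) : Phi 𝔓 A ⟶ A :=
  Sigma.desc fun x : PhiIndex 𝔓 A => x.2

/-- `Φ` on morphisms: `g : A ⟶ A'` sends the summand of `f` to the summand of `f ≫ g`. -/
def phiMap (𝔓 : ObjectProperty C) [ObjectProperty.Small.{v} 𝔓] {A A' : C} (g : A ⟶ A') :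
    Phi 𝔓 A ⟶ Phi 𝔓 A' :=
  Sigma.desc fun x : PhiIndex 𝔓 A => phiIn 𝔓 x.1.2 (x.2 ≫ g)

theorem phiIn_epsilon (𝔓 : ObjectProperty C) [ObjectProperty.Small.{v} 𝔓] {A P : C} (hP : 𝔓 P)
    (f : P ⟶ A) : phiIn 𝔓 hP f ≫ epsilon 𝔓 A = f := by
  exact Sigma.ι_desc _ _

theorem epsilon_naturality (𝔓 : ObjectProperty C) [ObjectProperty.Small.{v} 𝔓] {A A' : C}
    (g : A ⟶ A') : epsilon 𝔓 A ≫ g = phiMap 𝔓 g ≫ epsilon 𝔓 A' := by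
  apply Sigma.hom_ext
  intro x
  have h₁ : Sigma.ι (fun x : PhiIndex 𝔓 A => x.1.1) x ≫ epsilon 𝔓 A = x.2 := Sigma.ι_desc _ _
  have h₂ : Sigma.ι (fun x : PhiIndex 𝔓 A => x.1.1) x ≫ phiMap 𝔓 g =
    phiIn 𝔓 x.1.2 (x.2 ≫ g) := Sigma.ι_desc _ _
  rw [← Category.assoc, ← Category.assoc, h₁, h₂, phiIn_epsilon]

/-- The functor `A ↦ Coker(ε_A)` from `C` to itself. -/
def cokerEpsilon (𝔓 : ObjectProperty C) [ObjectProperty.Small.{v} 𝔓] : C ⥤ C where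
  obj A := cokernel (epsilon 𝔓 A)
  map g := cokernel.map _ _ (phiMap 𝔓 g) g (epsilon_naturality 𝔓 g)

theorem rightOrthogonal_cokernel_epsilon (𝔓 : ObjectProperty C) [ObjectProperty.Small.{v} 𝔓]
    (h𝔓 : ∀ P : C, 𝔓 P → Projective P) (A : C) :
    𝔓.rightOrthogonal (cokernel (epsilon 𝔓 A)) := by
  intro P f hP
  have := h𝔓 P hP
  rw [← Projective.factorThru_comp f (cokernel.π (epsilon 𝔓 A)),
    ← phiIn_epsilon 𝔓 hP (Projective.factorThru f (cokernel.π (epsilon 𝔓 A))),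
    Category.assoc, cokernel.condition, comp_zero]

/-- The functor `i^* : C ⥤ 𝔓^⊥`, `i^*(A) = Coker(ε_A)`. -/
def iStar (𝔓 : ObjectProperty C) [ObjectProperty.Small.{v} 𝔓]
    (h𝔓 : ∀ P : C, 𝔓 P → Projective P) : C ⥤ 𝔓.rightOrthogonal.FullSubcategory :=
  𝔓.rightOrthogonal.lift (cokerEpsilon 𝔓) (rightOrthogonal_cokernel_epsilon 𝔓 h𝔓)

/-- The canonical epimorphism `A ⟶ i_* i^*(A)`. -/
def iUnit (𝔓 : ObjectProperty C) [ObjectProperty.Small.{v} 𝔓]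
    (h𝔓 : ∀ P : C, 𝔓 P → Projective P) (A : C) : A ⟶ ((iStar 𝔓 h𝔓).obj A).obj :=
  cokernel.π (epsilon 𝔓 A)

end Abelian

section Resolutions

variable {C : Type u} [Category.{v} C] [Abelian C]

/-- `f : X ⟶ Y` is a `𝔓`-epimorphism: `Hom(P, X) → Hom(P, Y)` is onto for all `P` in `𝔓`. -/
def IsRelEpi (𝔓 : ObjectProperty C) {X Y : C} (f : X ⟶ Y) : Prop :=
  ∀ P : C, 𝔓 P → Function.Surjective fun g : P ⟶ X => g ≫ f

/-- `X` is `𝔓`-projective: it has the lifting property against all `𝔓`-epimorphisms. -/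
def IsRelProjective (𝔓 : ObjectProperty C) (X : C) : Prop :=
  ∀ ⦃Y Z : C⦄ (f : Y ⟶ Z), IsRelEpi 𝔓 f → ∀ g : X ⟶ Z, ∃ h : X ⟶ Y, h ≫ f = g

/-- `X` is a coproduct of a small family of objects of `𝔓`. -/
def IsCoproductOf (𝔓 : ObjectProperty C) (X : C) : Prop :=
  ∃ (I : Type v) (Q : I → C) (s : Cofan Q), (∀ i, 𝔓 (Q i)) ∧ Nonempty (IsColimit s) ∧
    Nonempty (s.pt ≅ X)

/-- The complex of abelian groups `Hom(P, K)` is exact. -/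
def HomExact (P : C) (K : CochainComplex C ℤ) : Prop :=
  ∀ i : ℤ, Function.Exact (fun f : P ⟶ K.X (i - 1) => f ≫ K.d (i - 1) i)
    (fun f : P ⟶ K.X i => f ≫ K.d i (i + 1))

/-- `A` as a complex concentrated in degree `0`. -/
abbrev stalk (A : C) : CochainComplex C ℤ :=
  (HomologicalComplex.single C (ComplexShape.up ℤ) 0).obj A

/-- A `𝔓`-projective resolution `⋯ → X₁ → X₀ → A → 0` of an object `A`, as one augmented complex.
It is written as a cochain complex: `A` sits in degree `0` and `Xₙ` in degree `-(n + 1)`.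
The identification of the degree `0` term with `A` is recorded as the inclusion of `A`,
concentrated in degree `0`, as a subcomplex. -/
structure Resolution (𝔓 : ObjectProperty C) (A : C) where
  complex : CochainComplex C ℤ
  isZero_X : ∀ i : ℤ, 0 < i → IsZero (complex.X i)
  inc : stalk A ⟶ complex
  isIso_inc : IsIso (inc.f 0)
  relProjective : ∀ i : ℤ, i < 0 → IsRelProjective 𝔓 (complex.X i)
  homExact : ∀ P : C, 𝔓 P → HomExact P complex

/-- The complex `K` is bounded above. -/
def IsBddAbove (K : CochainComplex C ℤ) : Prop := ∃ n : ℤ, ∀ i : ℤ, n < i → IsZero (K.X i)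

/-- A `𝔓`-projective resolution of a complex `K`: a morphism `p : X ⟶ K` from a bounded above
complex of `𝔓`-projective objects such that `Hom(P, p)` is a quasi-isomorphism for all `P` in `𝔓`;
as `Hom(P, -)` commutes with mapping cones, this says that `Hom(P, Cone p)` is exact. -/
structure IsComplexResolution (𝔓 : ObjectProperty C) {X K : CochainComplex C ℤ} (p : X ⟶ K) :
    Prop where
  bddAbove : IsBddAbove X
  relProjective : ∀ i : ℤ, IsRelProjective 𝔓 (X.X i)
  homExact : ∀ P : C, 𝔓 P → HomExact P (CochainComplex.mappingCone p)

theorem isBddAbove_stalk (A : C) : IsBddAbove (stalk A) :=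
  ⟨0, fun _ hi => HomologicalComplex.isZero_single_obj_X _ _ _ _ (ne_of_gt hi)⟩

theorem Resolution.isBddAbove {𝔓 : ObjectProperty C} {A : C} (R : Resolution 𝔓 A) :
    IsBddAbove R.complex :=
  ⟨0, R.isZero_X⟩

theorem isBddAbove_mappingCone {X K : CochainComplex C ℤ} (p : X ⟶ K) (hX : IsBddAbove X)
    (hK : IsBddAbove K) : IsBddAbove (CochainComplex.mappingCone p) := by
  obtain ⟨n, hn⟩ := hX
  obtain ⟨m, hm⟩ := hK
  refine ⟨max n m, fun i hi => ?_⟩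
  have h₁ : IsZero (X.X (i + 1)) := hn _ (by omega)
  have h₂ : IsZero (K.X i) := hm _ (by omega)
  rw [IsZero.iff_id_eq_zero,
    CochainComplex.mappingCone.ext_from_iff p (i + 1) i rfl]
  exact ⟨h₁.eq_of_src _ _, h₂.eq_of_src _ _⟩

end Resolutions

section Derived

variable {C : Type u} [Category.{v} C] [Abelian C] [HasDerivedCategory.{w} C]

theorem minus_Q_obj {K : CochainComplex C ℤ} (hK : IsBddAbove K) :
    (DerivedCategory.TStructure.t : Triangulated.TStructure (DerivedCategory C)).minus
      (DerivedCategory.Q.obj K) := by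
  obtain ⟨n, hn⟩ := hK
  exact ⟨n, ⟨⟨K, Iso.refl _, (CochainComplex.isStrictlyLE_iff K n).2 hn⟩⟩⟩

/-- The object of `D⁻(C)` represented by a bounded above complex. -/
def ofComplex (K : CochainComplex C ℤ) (hK : IsBddAbove K) : DerivedCategory.Minus C :=
  ⟨DerivedCategory.Q.obj K, minus_Q_obj hK⟩

/-- The morphism of `D⁻(C)` represented by a morphism of bounded above complexes. -/
def ofMap {K L : CochainComplex C ℤ} (f : K ⟶ L) (hK : IsBddAbove K) (hL : IsBddAbove L) :
    ofComplex K hK ⟶ ofComplex L hL :=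
  ObjectProperty.homMk (DerivedCategory.Q.map f)

/-- The objects of `D⁻(C)` all of whose (co)homology objects satisfy `B`. -/
def homologyIn (B : ObjectProperty C) : ObjectProperty (DerivedCategory.Minus C) :=
  fun X => ∀ n : ℤ, B ((DerivedCategory.homologyFunctor C n).obj X.obj)

/-- `D⁻_B(C)`, a full subcategory of `D⁻(C)`. -/
abbrev DMinus (B : ObjectProperty C) := (homologyIn B).FullSubcategory

/-- The full inclusion `j_* : D⁻_B(C) ⥤ D⁻(C)`. -/
abbrev jLower (B : ObjectProperty C) : DMinus B ⥤ DerivedCategory.Minus C := (homologyIn B).ι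

end Derived

end

end RelativeProjective

open RelativeProjective

namespace RelativeProjective

noncomputable section

/-! ### The orthogonal `𝔓^⊥` and its reflection `i^*`. -/

section Abelian

variable {C : Type u} [Category.{v} C] [Abelian C]

/-! Since the objects of `𝔓` are projective, `Hom(P, -)` commutes with homology, so a complex has
homology in `𝔓^⊥` exactly when `Hom(P, K)` is exact for all `P` in `𝔓`. Hence the cone of a
`𝔓`-projective resolution `p : X ⟶ K` lies in `D⁻_B`.

Conversely, a bounded above complex `X` of `𝔓`-projectives has no nonzero morphism to an object of
`D⁻_B` (`hom_eq_zero_of_relProjectiveComplexes`): `X` is K-projective, so the morphism is a chain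
map, and that map is null-homotopic by the comparison argument (`nonempty_homotopy_zero`). The
triangle `X → K → Cone p → X[1]` then makes `K → Cone p` a universal arrow to `D⁻_B`
(`isReflection_of_triangle`). Such arrows assemble into `j^*`, and their uniqueness lets every
resolution compute it.

Resolutions are built by descending recursion, covering the cocycles of the cone by `Phi`
(`exists_isComplexResolution`). The towers follow from universality alone, as `𝔓 (n + 1) ≤ 𝔓 n`
reverses the inclusion of the orthogonals. -/

theorem rightOrthogonal_containsZero (𝔓 : ObjectProperty C) :
    𝔓.rightOrthogonal.ContainsZero :=
  ⟨_, isZero_zero C, fun _ _ _ => (isZero_zero C).eq_of_tgt _ _⟩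

theorem rightOrthogonal_isClosedUnderKernels (𝔓 : ObjectProperty C) :
    𝔓.rightOrthogonal.IsClosedUnderKernels where
  kernels_le := by
    rintro _ ⟨f, k, hk, hf⟩ P g hP
    have := Fork.IsLimit.mono hk
    rw [← cancel_mono k.ι, zero_comp]
    exact hf.1 _ hP

/-- The one closure property that uses projectivity: a morphism from `P` to the cokernel lifts to
the target of `f`, where it vanishes. -/
theorem rightOrthogonal_isClosedUnderCokernels {𝔓 : ObjectProperty C}
    (h𝔓 : ∀ P : C, 𝔓 P → Projective P) :
    𝔓.rightOrthogonal.IsClosedUnderCokernels where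
  cokernels_le := by
    rintro _ ⟨f, k, hk, hf⟩ P g hP
    have := Cofork.IsColimit.epi hk
    have := h𝔓 P hP
    rw [← Projective.factorThru_comp g k.π, hf.2 (Projective.factorThru g k.π) hP, zero_comp]

theorem rightOrthogonal_isClosedUnderExtensions (𝔓 : ObjectProperty C) :
    𝔓.rightOrthogonal.IsClosedUnderExtensions where
  prop_X₂_of_shortExact := by
    intro S hS h₁ h₃ P g hP
    have := hS.mono_f
    rw [← hS.exact.lift_f g (h₃ _ hP), h₁ (hS.exact.lift g (h₃ _ hP)) hP, zero_comp]

theorem rightOrthogonal_isClosedUnderFiniteProducts (𝔓 : ObjectProperty C) :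
    𝔓.rightOrthogonal.IsClosedUnderFiniteProducts where
  isClosedUnderLimitsOfShape J _ :=
    { limitsOfShape_le := by
        rintro X ⟨h⟩ P g hP
        refine h.isLimit.hom_ext fun j => ?_
        rw [zero_comp]
        exact h.prop_diag_obj j _ hP }

theorem rightOrthogonal_exists_abelian {𝔓 : ObjectProperty C}
    (h𝔓 : ∀ P : C, 𝔓 P → Projective P) :
    (∃ a : Abelian 𝔓.rightOrthogonal.FullSubcategory,
        a.toPreadditive = (inferInstance : Preadditive 𝔓.rightOrthogonal.FullSubcategory)) ∧
      PreservesFiniteLimits 𝔓.rightOrthogonal.ι ∧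
      PreservesFiniteColimits 𝔓.rightOrthogonal.ι := by
  have := rightOrthogonal_containsZero 𝔓
  have := rightOrthogonal_isClosedUnderKernels 𝔓
  have := rightOrthogonal_isClosedUnderCokernels h𝔓
  have := rightOrthogonal_isClosedUnderFiniteProducts 𝔓
  let a : Abelian 𝔓.rightOrthogonal.FullSubcategory := inferInstance
  refine ⟨⟨a, rfl⟩, ?_, ?_⟩
  · have := 𝔓.rightOrthogonal.preservesKernels_ι
    exact Functor.preservesFiniteLimits_of_preservesKernels _
  · have := 𝔓.rightOrthogonal.preservesCokernels_ι
    exact Functor.preservesFiniteColimits_of_preservesCokernels _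

theorem rightOrthogonal_antitone {𝔓 𝔔 : ObjectProperty C} (h : 𝔓 ≤ 𝔔) :
    𝔔.rightOrthogonal ≤ 𝔓.rightOrthogonal :=
  fun _ hX _ f hP => hX f (h _ hP)

variable [HasCoproducts.{v} C]

/-- Each summand of `Phi 𝔓 A` lies in `𝔓`. This gives the factorisation through the cokernel, hence
the universal property of `i^*`. -/
theorem epsilon_comp_eq_zero (𝔓 : ObjectProperty C) [ObjectProperty.Small.{v} 𝔓] {A B : C}
    (g : A ⟶ B) (hB : 𝔓.rightOrthogonal B) : epsilon 𝔓 A ≫ g = 0 := by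
  apply Sigma.hom_ext
  rintro ⟨⟨P, hP⟩, f⟩
  exact (hB _ hP).trans (hB _ hP).symm

instance epi_iUnit (𝔓 : ObjectProperty C) [ObjectProperty.Small.{v} 𝔓]
    (h𝔓 : ∀ P : C, 𝔓 P → Projective P) (A : C) : Epi (iUnit 𝔓 h𝔓 A) :=
  inferInstanceAs (Epi (cokernel.π (epsilon 𝔓 A)))

theorem iUnit_naturality (𝔓 : ObjectProperty C) [ObjectProperty.Small.{v} 𝔓]
    (h𝔓 : ∀ P : C, 𝔓 P → Projective P) {A A' : C} (g : A ⟶ A') :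
    iUnit 𝔓 h𝔓 A ≫ ((iStar 𝔓 h𝔓).map g).hom = g ≫ iUnit 𝔓 h𝔓 A' :=
  cokernel.π_desc _ _ _

/-- The unique factorisation through `i_* i^*(A)` of a morphism from `A` to an object of `𝔓^⊥`. -/
def iDesc (𝔓 : ObjectProperty C) [ObjectProperty.Small.{v} 𝔓]
    (h𝔓 : ∀ P : C, 𝔓 P → Projective P) {A B : C} (g : A ⟶ B) (hB : 𝔓.rightOrthogonal B) :
    ((iStar 𝔓 h𝔓).obj A).obj ⟶ B :=
  cokernel.desc (epsilon 𝔓 A) g (epsilon_comp_eq_zero 𝔓 g hB)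

theorem iUnit_iDesc (𝔓 : ObjectProperty C) [ObjectProperty.Small.{v} 𝔓]
    (h𝔓 : ∀ P : C, 𝔓 P → Projective P) {A B : C} (g : A ⟶ B) (hB : 𝔓.rightOrthogonal B) :
    iUnit 𝔓 h𝔓 A ≫ iDesc 𝔓 h𝔓 g hB = g :=
  cokernel.π_desc _ _ _

theorem exists_iStar_adjunction (𝔓 : ObjectProperty C) [ObjectProperty.Small.{v} 𝔓]
    (h𝔓 : ∀ P : C, 𝔓 P → Projective P) :
    ∃ adj : iStar 𝔓 h𝔓 ⊣ 𝔓.rightOrthogonal.ι, ∀ A : C, adj.unit.app A = iUnit 𝔓 h𝔓 A := by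
  refine ⟨Adjunction.mkOfHomEquiv
    { homEquiv := fun A B =>
        { toFun := fun g => iUnit 𝔓 h𝔓 A ≫ g.hom
          invFun := fun g => ObjectProperty.homMk (iDesc 𝔓 h𝔓 g B.property)
          left_inv := fun g => by
            ext
            rw [← cancel_epi (iUnit 𝔓 h𝔓 A)]
            exact iUnit_iDesc _ _ _ B.property
          right_inv := fun g => iUnit_iDesc _ _ _ B.property }
      homEquiv_naturality_left_symm := fun {A' A B} f g => by
        ext
        rw [← cancel_epi (iUnit 𝔓 h𝔓 A')]
        refine (iUnit_iDesc _ _ _ B.property).trans ?_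
        refine Eq.trans ?_ (Category.assoc _ _ _)
        rw [iUnit_naturality, Category.assoc]
        exact congrArg (f ≫ ·) (iUnit_iDesc _ _ g B.property).symm
      homEquiv_naturality_right := fun f g => (Category.assoc _ _ _).symm }, fun A => ?_⟩
  rw [Adjunction.mkOfHomEquiv_unit_app]
  exact Category.comp_id _

theorem exists_unique_iStar_tower (𝔓 : ℕ → ObjectProperty C)
    [∀ n, ObjectProperty.Small.{v} (𝔓 n)] (h𝔓 : ∀ (n : ℕ) (P : C), 𝔓 n P → Projective P)
    (h : ∀ n, 𝔓 (n + 1) ≤ 𝔓 n) :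
    ∃! τ : ∀ n : ℕ, iStar (𝔓 (n + 1)) (h𝔓 (n + 1)) ⋙ (𝔓 (n + 1)).rightOrthogonal.ι ⟶
        iStar (𝔓 n) (h𝔓 n) ⋙ (𝔓 n).rightOrthogonal.ι,
      ∀ (n : ℕ) (A : C),
        iUnit (𝔓 (n + 1)) (h𝔓 (n + 1)) A ≫ (τ n).app A = iUnit (𝔓 n) (h𝔓 n) A ∧
          Epi ((τ n).app A) := by
  have hB (n : ℕ) (A : C) : (𝔓 (n + 1)).rightOrthogonal ((iStar (𝔓 n) (h𝔓 n)).obj A).obj :=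
    rightOrthogonal_antitone (h n) _ ((iStar (𝔓 n) (h𝔓 n)).obj A).property
  refine ⟨fun n =>
    { app := fun A => iDesc (𝔓 (n + 1)) (h𝔓 (n + 1)) (iUnit (𝔓 n) (h𝔓 n) A) (hB n A)
      naturality := fun A A' g => ?_ }, fun n A => ⟨iUnit_iDesc _ _ _ (hB n A), ?_⟩, fun τ hτ => ?_⟩
  · rw [← cancel_epi (iUnit (𝔓 (n + 1)) (h𝔓 (n + 1)) A)]
    dsimp
    rw [← Category.assoc, iUnit_naturality, Category.assoc, iUnit_iDesc,
      reassoc_of% iUnit_iDesc (𝔓 (n + 1)), iUnit_naturality]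
  · exact epi_of_epi_fac (iUnit_iDesc (𝔓 (n + 1)) (h𝔓 (n + 1)) _ (hB n A))
  · funext n
    ext A
    rw [← cancel_epi (iUnit (𝔓 (n + 1)) (h𝔓 (n + 1)) A)]
    exact (hτ n A).1.trans (iUnit_iDesc _ _ _ (hB n A)).symm

end Abelian

/-! ### Existence of `𝔓`-projective resolutions. -/

section

/-- Downward recursion on `ℤ`: dependent choice along a relation between consecutive degrees,
starting from a given family in degrees `≥ N`. -/
theorem exists_descending_family {σ : ℤ → Type*}
    (R : ∀ n m : ℤ, n + 1 = m → σ n → σ m → Prop) (N : ℤ) (z : ∀ n, N ≤ n → σ n)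
    (hz : ∀ (n m : ℤ) (h : n + 1 = m) (hn : N ≤ n), R n m h (z n hn) (z m (by omega)))
    (step : ∀ (n m : ℤ) (h : n + 1 = m) (b : σ m), ∃ a, R n m h a b) :
    ∃ s : ∀ n, σ n, (∀ n (hn : N ≤ n), s n = z n hn) ∧
      ∀ (n m : ℤ) (h : n + 1 = m), R n m h (s n) (s m) := by
  choose f hf using step
  -- The upward branch ignores the recursive value and returns `z`; only the downward branch uses
  -- the chosen `f`.
  let s : ∀ n, σ n := fun n => Int.inductionOn' (motive := σ) n N (z N le_rfl)
    (fun k hk _ => z (k + 1) (by omega))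
    (fun k _ b => f (k - 1) k (by omega) b)
  have h₁ : ∀ n (hn : N ≤ n), s n = z n hn := fun n hn => by
    obtain rfl | hn := hn.eq_or_lt
    · exact Int.inductionOn'_self ..
    · obtain ⟨k, rfl⟩ : ∃ k, n = k + 1 := ⟨n - 1, by omega⟩
      exact Int.inductionOn'_add_one (by omega)
  refine ⟨s, h₁, fun n m h => ?_⟩
  by_cases hn : N ≤ n
  · rw [h₁ n hn, h₁ m (by omega)]
    exact hz n m h hn
  · obtain rfl : n = m - 1 := by omega
    have : s (m - 1) = f (m - 1) m (by omega) (s m) := Int.inductionOn'_sub_one (by omega)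
    rw [this]
    exact hf _ _ _ _

variable {C : Type u} [Category.{v} C]

theorem IsCoproductOf.of_iso {𝔓 : ObjectProperty C} {X Y : C} (h : IsCoproductOf 𝔓 X)
    (e : X ≅ Y) : IsCoproductOf 𝔓 Y := by
  obtain ⟨I, Q, s, hQ, hs, ⟨e'⟩⟩ := h
  exact ⟨I, Q, s, hQ, hs, ⟨e' ≪≫ e⟩⟩

/-- `PhiIndex` lives in `Type max u v`, so the coproduct is reindexed along its `v`-small model. -/
theorem isCoproductOf_Phi [HasCoproducts.{v} C] (𝔓 : ObjectProperty C)
    [ObjectProperty.Small.{v} 𝔓] (A : C) : IsCoproductOf 𝔓 (Phi 𝔓 A) := by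
  let e := equivShrink.{v} (PhiIndex 𝔓 A)
  refine ⟨Shrink.{v} (PhiIndex 𝔓 A), fun i => (e.symm i).1.1,
    Cofan.mk _ (Sigma.ι fun i => (e.symm i).1.1), fun i => (e.symm i).1.2,
    ⟨coproductIsCoproduct _⟩, ⟨Sigma.reindex e.symm fun x : PhiIndex 𝔓 A => x.1.1⟩⟩

theorem IsCoproductOf.isRelProjective {𝔓 : ObjectProperty C} {X : C} (h : IsCoproductOf 𝔓 X) :
    IsRelProjective 𝔓 X := by
  obtain ⟨I, Q, s, hQ, ⟨hs⟩, ⟨e⟩⟩ := h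
  intro Y Z f hf g
  choose φ hφ using fun i => hf _ (hQ i) (s.inj i ≫ e.hom ≫ g)
  refine ⟨e.inv ≫ Cofan.IsColimit.desc hs φ, ?_⟩
  rw [Category.assoc, Iso.inv_comp_eq]
  refine Cofan.IsColimit.hom_ext hs _ _ fun i => ?_
  rw [Cofan.IsColimit.fac_assoc]
  exact hφ i

variable [Abelian C]

theorem isCoproductOf_of_isZero (𝔓 : ObjectProperty C) {X : C} (hX : IsZero X) :
    IsCoproductOf 𝔓 X :=
  ⟨PEmpty, PEmpty.elim, Cofan.mk X fun i => i.elim, fun i => i.elim,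
    ⟨Cofan.IsColimit.mk _ (fun _ => 0) (fun _ i => i.elim) fun _ _ _ => hX.eq_of_src _ _⟩,
    ⟨Iso.refl _⟩⟩

theorem isRelEpi_epsilon [HasCoproducts.{v} C] (𝔓 : ObjectProperty C)
    [ObjectProperty.Small.{v} 𝔓] (A : C) : IsRelEpi 𝔓 (epsilon 𝔓 A) :=
  fun _ hP f => ⟨phiIn 𝔓 hP f, phiIn_epsilon 𝔓 hP f⟩

open CochainComplex HomComplex in
-- A `P`-point of the cone is a pair `(x, k)`, a cocycle when `dx = 0` and `p(x) + dk = 0`. The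
-- hypothesis is this condition with `k` replaced by `-k`, which frees the construction below from
-- signs.
theorem homExact_mappingCone {P : C} {X K : CochainComplex C ℤ} (p : X ⟶ K)
    (h : ∀ (i j : ℤ) (_ : i + 1 = j) (x : P ⟶ X.X j) (k : P ⟶ K.X i),
      x ≫ X.d j (j + 1) = 0 → x ≫ p.f j = k ≫ K.d i j →
        ∃ z : P ⟶ X.X i, z ≫ X.d i j = x ∧ z ≫ p.f i = k) :
    HomExact P (mappingCone p) := by
  intro i g
  constructor
  · intro hg
    have hg : g ≫ (mappingCone p).d i (i + 1) = 0 := hg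
    have h₁ := hg =≫ (mappingCone.fst p).1.v (i + 1) (i + 2) (by omega)
    have h₂ := hg =≫ (mappingCone.snd p).v (i + 1) (i + 1) (by omega)
    rw [Category.assoc, mappingCone.d_fst_v _ i (i + 1) (i + 2) rfl (by omega), zero_comp] at h₁
    rw [Category.assoc, mappingCone.d_snd_v _ i (i + 1) rfl, zero_comp] at h₂
    obtain ⟨z, hz₁, hz₂⟩ := h i (i + 1) rfl
      (g ≫ (mappingCone.fst p).1.v i (i + 1) rfl) (-(g ≫ (mappingCone.snd p).v i i (add_zero i)))
      (by
        obtain h : i + 2 = i + 1 + 1 := by omega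
        rw [h] at h₁
        simpa using h₁)
      (by
        rw [Category.assoc, Preadditive.neg_comp, Category.assoc]
        rw [Preadditive.comp_add] at h₂
        exact eq_neg_of_add_eq_zero_left h₂)
    refine ⟨-(z ≫ (mappingCone.inl p).v i (i - 1) (by omega)), ?_⟩
    dsimp only
    rw [Preadditive.neg_comp, Category.assoc, mappingCone.inl_v_d p i (i - 1) (i + 1) (by omega)
      (by omega), Preadditive.comp_sub, reassoc_of% hz₁, reassoc_of% hz₂]
    rw [mappingCone.ext_to_iff p i (i + 1) rfl]
    constructor <;> simp
  · rintro ⟨f, rfl⟩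
    simp

/-- A `𝔓`-epimorphism `e : X ⟶ W` onto the cocycles in degree `n - 1` of the cone of a partially
constructed resolution of `K`, together with the map from `K` to these cocycles. -/
structure CocycleCover (𝔓 : ObjectProperty C) (K : CochainComplex C ℤ) (n : ℤ) where
  W : C
  X : C
  e : X ⟶ W
  ι : ∀ j : ℤ, j + 1 = n → (K.X j ⟶ W)
  isRelEpi : IsRelEpi 𝔓 e
  isCoproductOf : IsCoproductOf 𝔓 X
  d_ι : ∀ (i j : ℤ) (hj : j + 1 = n), K.d i j ≫ ι j hj = 0

namespace CocycleCover

variable {𝔓 : ObjectProperty C} {K : CochainComplex C ℤ}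

/-- The cover in degree `n` prolongs the cover in degree `m = n + 1`. -/
structure Link {n m : ℤ} (h : n + 1 = m) (a : CocycleCover 𝔓 K n) (b : CocycleCover 𝔓 K m) where
  fst : a.W ⟶ b.X
  snd : a.W ⟶ K.X n
  isPullback : IsPullback fst snd b.e (b.ι n h)
  ι_fst : ∀ (j : ℤ) (hj : j + 1 = n), a.ι j hj ≫ fst = 0
  ι_snd : ∀ (j : ℤ) (hj : j + 1 = n), a.ι j hj ≫ snd = K.d j n

/-- The pullback consists of the pairs `(x, k)` in `X^m ⊕ K^n` with equal images in `b.W`. When `b`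
is itself linked to the next cover, `b.W` is again such a pullback and the condition reads `dx = 0`,
`p(x) = dk`. Covering by `Phi` makes all `P`-points of the pullback lift. -/
theorem exists_link [HasCoproducts.{v} C] [ObjectProperty.Small.{v} 𝔓] (n m : ℤ) (h : n + 1 = m)
    (b : CocycleCover 𝔓 K m) : ∃ a : CocycleCover 𝔓 K n, Nonempty (Link h a b) := by
  refine ⟨
    { W := pullback b.e (b.ι n h)
      X := Phi 𝔓 (pullback b.e (b.ι n h))
      e := epsilon 𝔓 _
      ι := fun j _ => pullback.lift 0 (K.d j n) (by rw [zero_comp, b.d_ι])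
      isRelEpi := isRelEpi_epsilon 𝔓 _
      isCoproductOf := isCoproductOf_Phi 𝔓 _
      d_ι := fun i j _ => by ext <;> simp [pullback.lift_fst, pullback.lift_snd] }, ⟨
    { fst := pullback.fst _ _
      snd := pullback.snd _ _
      isPullback := IsPullback.of_hasPullback _ _
      ι_fst := fun j _ => pullback.lift_fst _ _ _
      ι_snd := fun j _ => pullback.lift_snd _ _ _ }⟩⟩

/-- The cover by the zero object. -/
def zero (𝔓 : ObjectProperty C) (K : CochainComplex C ℤ) (n : ℤ) : CocycleCover 𝔓 K n where
  W := ⊥_ C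
  X := ⊥_ C
  e := 0
  ι _ _ := 0
  isRelEpi _ _ _ := ⟨0, initialIsInitial.isZero.eq_of_tgt _ _⟩
  isCoproductOf := isCoproductOf_of_isZero 𝔓 initialIsInitial.isZero
  d_ι _ _ _ := comp_zero

theorem nonempty_link_zero {n m : ℤ} (h : n + 1 = m) (hK : IsZero (K.X n)) :
    Nonempty (Link h (zero 𝔓 K n) (zero 𝔓 K m)) :=
  ⟨{ fst := 0
     snd := 0
     isPullback :=
       have : IsIso (0 : (zero 𝔓 K n).W ⟶ K.X n) := ⟨0, initialIsInitial.isZero.eq_of_src _ _,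
         hK.eq_of_src _ _⟩
       have : IsIso (zero 𝔓 K m).e := ⟨0, initialIsInitial.isZero.eq_of_src _ _,
         initialIsInitial.isZero.eq_of_src _ _⟩
       IsPullback.of_vert_isIso ⟨IsZero.eq_of_src initialIsInitial.isZero _ _⟩
     ι_fst := fun _ _ => comp_zero
     ι_snd := fun _ _ => hK.eq_of_tgt _ _ }⟩

variable (s : ∀ n, CocycleCover 𝔓 K n) (l : ∀ (n m : ℤ) (h : n + 1 = m), Link h (s n) (s m))

/-- The two hypotheses say that `x` and `y` agree in `(s j).W`, tested on its two projections. So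
`(x, y)` is a `P`-point of the pullback `(s i).W`, which lifts along the `𝔓`-epimorphism `(s i).e`.
-/
theorem exists_lift {P : C} (hP : 𝔓 P) (i j k : ℤ) (hij : i + 1 = j) (hjk : j + 1 = k)
    (x : P ⟶ (s j).X) (y : P ⟶ K.X i) (hx : x ≫ (s j).e ≫ (l j k hjk).fst = 0)
    (hy : x ≫ (s j).e ≫ (l j k hjk).snd = y ≫ K.d i j) :
    ∃ z : P ⟶ (s i).X, z ≫ (s i).e ≫ (l i j hij).fst = x ∧
      z ≫ (s i).e ≫ (l i j hij).snd = y := by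
  have hxy : x ≫ (s j).e = y ≫ (s j).ι i hij := by
    apply (l j k hjk).isPullback.hom_ext
    · rw [Category.assoc, Category.assoc, hx, (l j k hjk).ι_fst, comp_zero]
    · rw [Category.assoc, Category.assoc, hy, (l j k hjk).ι_snd]
  obtain ⟨z, hz⟩ := (s i).isRelEpi P hP ((l i j hij).isPullback.lift _ _ hxy)
  dsimp only at hz
  exact ⟨z, by rw [reassoc_of% hz, IsPullback.lift_fst],
    by rw [reassoc_of% hz, IsPullback.lift_snd]⟩

/-- The resolution assembled from a compatible family of covers. -/
def complex : CochainComplex C ℤ where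
  X n := (s n).X
  d i j := if h : i + 1 = j then (s i).e ≫ (l i j h).fst else 0
  shape i j h := dif_neg h
  d_comp_d' i j k := by
    -- The square gives `fst ≫ e = snd ≫ ι`, and `ι ≫ fst = 0`.
    rintro rfl rfl
    simp [reassoc_of% (l i (i + 1) rfl).isPullback.w,
      (l (i + 1) (i + 1 + 1) rfl).ι_fst]

theorem complex_d (i j : ℤ) (h : i + 1 = j) :
    (complex s l).d i j = (s i).e ≫ (l i j h).fst :=
  dif_pos h

/-- The augmentation of the resolution assembled from a compatible family of covers. -/
def augmentation : complex s l ⟶ K where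
  f n := (s n).e ≫ (l n (n + 1) rfl).snd
  comm' i j := by
    rintro rfl
    have h : ((s i).e ≫ (l i (i + 1) rfl).snd) ≫ K.d i (i + 1) =
        ((s i).e ≫ (l i (i + 1) rfl).fst) ≫ (s (i + 1)).e ≫ (l (i + 1) _ rfl).snd := by
      rw [Category.assoc, Category.assoc, reassoc_of% (l i (i + 1) rfl).isPullback.w,
        (l (i + 1) _ rfl).ι_snd]
    exact h.trans (congrArg (· ≫ _) (complex_d s l i (i + 1) rfl).symm)

theorem augmentation_f (i j : ℤ) (h : i + 1 = j) :
    (augmentation s l).f i = (s i).e ≫ (l i j h).snd := by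
  subst h
  rfl

theorem homExact_augmentation (P : C) (hP : 𝔓 P) :
    HomExact P (CochainComplex.mappingCone (augmentation s l)) := by
  refine homExact_mappingCone _ fun i j hij x k hx hk => ?_
  rw [complex_d s l j (j + 1) rfl] at hx
  rw [complex_d s l i j hij, augmentation_f s l i j hij]
  exact exists_lift s l hP i j (j + 1) hij rfl x k hx hk

end CocycleCover

/-- A bounded above complex has a `𝔓`-projective resolution by coproducts of objects of `𝔓`, which
vanishes in degrees where `K` and the later terms of `K` vanish. -/
theorem exists_isComplexResolution [HasCoproducts.{v} C] (𝔓 : ObjectProperty C)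
    [ObjectProperty.Small.{v} 𝔓] (K : CochainComplex C ℤ) (N : ℤ)
    (hK : ∀ i : ℤ, N < i → IsZero (K.X i)) :
    ∃ (X : CochainComplex C ℤ) (p : X ⟶ K), IsComplexResolution 𝔓 p ∧
      (∀ i : ℤ, IsCoproductOf 𝔓 (X.X i)) ∧ ∀ i : ℤ, N < i → IsZero (X.X i) := by
  obtain ⟨s, hs, hl⟩ := exists_descending_family
    (fun n m h a b => Nonempty (CocycleCover.Link (𝔓 := 𝔓) (K := K) h a b)) (N + 1)
    (fun n _ => CocycleCover.zero 𝔓 K n)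
    (fun n m h hn => CocycleCover.nonempty_link_zero h (hK n (by omega)))
    CocycleCover.exists_link
  let l n m h := (hl n m h).some
  have hX (i : ℤ) (hi : N < i) : IsZero ((CocycleCover.complex s l).X i) := by
    change IsZero (s i).X
    rw [hs i (by omega)]
    exact initialIsInitial.isZero
  exact ⟨CocycleCover.complex s l, CocycleCover.augmentation s l,
    ⟨⟨N, hX⟩, fun i => (s i).isCoproductOf.isRelProjective,
      CocycleCover.homExact_augmentation s l⟩, fun i => (s i).isCoproductOf, hX⟩

theorem isZero_mappingCone_X {X K : CochainComplex C ℤ} (p : X ⟶ K) {i j : ℤ} (hij : i + 1 = j)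
    (hX : IsZero (X.X j)) (hK : IsZero (K.X i)) : IsZero ((CochainComplex.mappingCone p).X i) := by
  rw [IsZero.iff_id_eq_zero, CochainComplex.mappingCone.ext_from_iff p j i hij]
  exact ⟨hX.eq_of_src _ _, hK.eq_of_src _ _⟩

/-- If `K` vanishes in degree `i`, the cone of `p : X ⟶ K` has the term `X^(i+1)` in degree `i`. -/
def mappingConeXIsoSource {X K : CochainComplex C ℤ} (p : X ⟶ K) {i j : ℤ} (hij : i + 1 = j)
    (hK : IsZero (K.X i)) : (CochainComplex.mappingCone p).X i ≅ X.X j where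
  hom := (CochainComplex.mappingCone.fst p).1.v i j hij
  inv := (CochainComplex.mappingCone.inl p).v j i (by omega)
  hom_inv_id := by
    rw [CochainComplex.mappingCone.ext_from_iff p j i hij]
    exact ⟨by simp, hK.eq_of_src _ _⟩

theorem isIso_mappingCone_inr_f {X K : CochainComplex C ℤ} (p : X ⟶ K) {i j : ℤ}
    (hij : i + 1 = j) (hX : IsZero (X.X j)) :
    IsIso ((CochainComplex.mappingCone.inr p).f i) := by
  refine ⟨(CochainComplex.mappingCone.snd p).v i i (add_zero i), by simp, ?_⟩
  rw [CochainComplex.mappingCone.ext_from_iff p j i hij]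
  exact ⟨hX.eq_of_src _ _, by simp⟩

/-- The augmented complex is the cone of a resolution `X` of the stalk: its term is `X^(i+1)` in
degree `i < 0`, and `A` in degree `0` because `X` can be chosen with `X^1 = 0`. -/
theorem exists_resolution [HasCoproducts.{v} C] (𝔓 : ObjectProperty C)
    [ObjectProperty.Small.{v} 𝔓] (A : C) :
    ∃ R : Resolution 𝔓 A, ∀ i : ℤ, i < 0 → IsCoproductOf 𝔓 (R.complex.X i) := by
  have hA (i : ℤ) (hi : i ≠ 0) : IsZero ((stalk A).X i) :=
    HomologicalComplex.isZero_single_obj_X _ _ _ _ hi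
  obtain ⟨X, p, hp, hc, hX⟩ := exists_isComplexResolution 𝔓 (stalk A) 0 fun i hi => hA i hi.ne'
  have hc' (i : ℤ) (hi : i < 0) : IsCoproductOf 𝔓 ((CochainComplex.mappingCone p).X i) :=
    (hc _).of_iso (mappingConeXIsoSource p rfl (hA i hi.ne)).symm
  exact ⟨
    { complex := CochainComplex.mappingCone p
      isZero_X := fun i hi => isZero_mappingCone_X p rfl (hX _ (by omega)) (hA i hi.ne')
      inc := CochainComplex.mappingCone.inr p
      isIso_inc := isIso_mappingCone_inr_f p rfl (hX _ (by omega))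
      relProjective := fun i hi => (hc' i hi).isRelProjective
      homExact := hp.homExact }, hc'⟩

end

/-! ### Relative exactness and null-homotopies. -/

section

variable {C : Type u} [Category.{v} C] {𝔓 : ObjectProperty C}

theorem IsRelProjective.of_iso {X Y : C} (h : IsRelProjective 𝔓 X)
    (e : X ≅ Y) : IsRelProjective 𝔓 Y := by
  intro Y Z f hf g
  obtain ⟨a, ha⟩ := h f hf (e.hom ≫ g)
  exact ⟨e.inv ≫ a, by rw [Category.assoc, ha, Iso.inv_hom_id_assoc]⟩

/-- Every epimorphism is a `𝔓`-epimorphism when `𝔓` consists of projectives. This is what makes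
bounded above complexes of `𝔓`-projectives K-projective. -/
theorem IsRelProjective.projective (h𝔓 : ∀ P : C, 𝔓 P → Projective P) {X : C}
    (h : IsRelProjective 𝔓 X) : Projective X where
  factors f e _ := h e (fun P hP g =>
    have := h𝔓 P hP
    ⟨Projective.factorThru g e, Projective.factorThru_comp g e⟩) f

variable [Abelian C]

theorem isRelProjective_of_isZero {X : C} (h : IsZero X) : IsRelProjective 𝔓 X :=
  fun _ _ _ _ _ => ⟨0, h.eq_of_src _ _⟩

/-- A cocycle `P ⟶ Z^i` dies in `H^i`, so it lifts along `K^(i-1) → Z^i` because `P` is projective.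
-/
theorem homExact_of_rightOrthogonal_homology (h𝔓 : ∀ P : C, 𝔓 P → Projective P)
    {K : CochainComplex C ℤ} (hK : ∀ i : ℤ, 𝔓.rightOrthogonal (K.homology i)) {P : C} (hP : 𝔓 P) :
    HomExact P K := by
  intro i f
  constructor
  · intro hf
    have hf : f ≫ K.d i (i + 1) = 0 := hf
    have := h𝔓 P hP
    have hprev : (ComplexShape.up ℤ).prev i = i - 1 := by simp
    have hnext : (ComplexShape.up ℤ).next i = i + 1 := by simp
    have hS : (ShortComplex.mk _ _ (K.toCycles_comp_homologyπ (i - 1) i)).Exact :=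
      ShortComplex.exact_of_g_is_cokernel _ (K.homologyIsCokernel (i - 1) i hprev)
    refine ⟨hS.liftFromProjective (K.liftCycles f (i + 1) hnext hf) (hK i _ hP), ?_⟩
    dsimp only
    rw [← K.toCycles_i (i - 1) i, ← Category.assoc]
    exact (hS.liftFromProjective_comp (K.liftCycles f (i + 1) hnext hf) (hK i _ hP) =≫ _).trans
      (K.liftCycles_i _ _ _ _)
  · rintro ⟨g, rfl⟩
    simp

theorem HomExact.exists_comp_toCycles {P : C} {K : CochainComplex C ℤ} (h : HomExact P K)
    {i j : ℤ} (hij : i + 1 = j) (f : P ⟶ K.cycles j) : ∃ g : P ⟶ K.X i, g ≫ K.toCycles i j = f := by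
  obtain rfl : i = j - 1 := by omega
  obtain ⟨g, hg⟩ := (h j (f ≫ K.iCycles j)).1 (by simp)
  exact ⟨g, by rw [← cancel_mono (K.iCycles j), Category.assoc, K.toCycles_i]; exact hg⟩

theorem rightOrthogonal_homology_of_homExact (h𝔓 : ∀ P : C, 𝔓 P → Projective P)
    {K : CochainComplex C ℤ} (hK : ∀ P : C, 𝔓 P → HomExact P K) (i : ℤ) :
    𝔓.rightOrthogonal (K.homology i) := by
  intro P f hP
  have := h𝔓 P hP
  obtain ⟨g, hg⟩ := (hK P hP).exists_comp_toCycles (i := i - 1) (by omega)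
    (Projective.factorThru f (K.homologyπ i))
  rw [← Projective.factorThru_comp f (K.homologyπ i), ← hg, Category.assoc,
    K.toCycles_comp_homologyπ, comp_zero]

/-- Relative exactness says that `K^i → Z^j` is a `𝔓`-epimorphism. -/
theorem IsRelProjective.exists_lift_cocycle {X : C} (hX : IsRelProjective 𝔓 X)
    {K : CochainComplex C ℤ} (hK : ∀ P : C, 𝔓 P → HomExact P K) {i j k : ℤ} (hij : i + 1 = j)
    (hjk : j + 1 = k) (f : X ⟶ K.X j) (hf : f ≫ K.d j k = 0) :
    ∃ g : X ⟶ K.X i, g ≫ K.d i j = f := by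
  obtain ⟨g, hg⟩ := hX (K.toCycles i j) (fun P hP => (hK P hP).exists_comp_toCycles hij)
    (K.liftCycles f k (by simp [← hjk]) hf)
  exact ⟨g, by rw [← K.toCycles_i i j, reassoc_of% hg, K.liftCycles_i]⟩

/-- A morphism from a bounded above complex of `𝔓`-projective objects to a complex which is exact
relatively to `𝔓` is null-homotopic. -/
theorem nonempty_homotopy_zero {X K : CochainComplex C ℤ} (hX : IsBddAbove X)
    (hX' : ∀ i, IsRelProjective 𝔓 (X.X i)) (hK : ∀ P : C, 𝔓 P → HomExact P K) (f : X ⟶ K) :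
    Nonempty (Homotopy f 0) := by
  obtain ⟨N, hN⟩ := hX
  -- The state is the homotopy component `X^n ⟶ K^(n-1)`, with the invariant that makes the next
  -- obstruction a cocycle. Quantifying over `j` with `j + 1 = n` avoids transport along `n - 1 + 1
  -- = n`.
  let σ (n : ℤ) : Type v := { a : ∀ j : ℤ, j + 1 = n → (X.X n ⟶ K.X j) //
    ∀ (i j : ℤ) (hj : j + 1 = n), X.d i n ≫ (f.f n - a j hj ≫ K.d j n) = 0 }
  obtain ⟨s, -, hs⟩ := exists_descending_family (σ := σ)
    (fun n m h a b => ∀ (j : ℤ) (hj : j + 1 = n),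
      f.f n = X.d n m ≫ b.1 n h + a.1 j hj ≫ K.d j n) (N + 1)
    (fun n hn => ⟨fun _ _ => 0, fun i j hj => by
      rw [(hN n (by omega)).eq_of_src (f.f n - _) 0, comp_zero]⟩)
    (fun n m h hn j hj => (hN n (by omega)).eq_of_src _ _)
    (fun n m h b => by
      -- By the invariant of `b`, what remains of `f` in degree `n` is a cocycle; a lift of it along
      -- `d` is the next component, and `d ∘ d = 0` in `X` restores the invariant.
      have hb : (f.f n - X.d n m ≫ b.1 n h) ≫ K.d n m = 0 := by
        have := b.2 n n h
        rw [Preadditive.comp_sub] at this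
        rw [Preadditive.sub_comp, f.comm, Category.assoc, this]
      choose a ha using fun (j : ℤ) (hj : j + 1 = n) =>
        (hX' n).exists_lift_cocycle hK hj h _ hb
      exact ⟨⟨a, fun i j hj => by rw [ha, sub_sub_cancel, X.d_comp_d_assoc, zero_comp]⟩,
        fun j hj => by rw [ha, add_sub_cancel]⟩)
  refine ⟨
    { hom := fun i j => if h : j + 1 = i then (s i).1 j h else 0
      zero := fun i j h => dif_neg h
      comm := fun i => ?_ }⟩
  rw [dNext_eq _ (show (ComplexShape.up ℤ).Rel i (i + 1) from rfl),
    prevD_eq _ (show (ComplexShape.up ℤ).Rel (i - 1) i by simp), dif_pos rfl,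
    dif_pos (show i - 1 + 1 = i by omega), HomologicalComplex.zero_f, add_zero]
  exact hs i (i + 1) rfl (i - 1) (by omega)

end

/-! ### Orthogonality in the derived category and universal arrows. -/

section

open DerivedCategory

variable {C : Type u} [Category.{v} C] [Abelian C] [HasDerivedCategory.{w} C]
  {𝔓 : ObjectProperty C}

theorem Q_map_surjective_of_isKProjective (K L : CochainComplex C ℤ) [K.IsKProjective] :
    Function.Surjective (fun f : K ⟶ L => Q.map f) := by
  intro g
  obtain ⟨f, hf⟩ := (CochainComplex.IsKProjective.Qh_map_bijective K
    ((HomotopyCategory.quotient _ _).obj L)).surjective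
      ((quotientCompQhIso C).hom.app K ≫ g ≫ (quotientCompQhIso C).inv.app L)
  obtain ⟨f, rfl⟩ := (HomotopyCategory.quotient _ _).map_surjective f
  refine ⟨f, ?_⟩
  have h := (quotientCompQhIso C).hom.naturality f
  dsimp only
  rw [← cancel_epi ((quotientCompQhIso C).hom.app K), ← h]
  dsimp only [Functor.comp_map]
  rw [hf]
  simp

/-- The objects of the derived category represented by bounded above complexes of `𝔓`-projective
objects. -/
def relProjectiveComplexes (𝔓 : ObjectProperty C) : ObjectProperty (DerivedCategory C) :=
  fun Y => ∃ X : CochainComplex C ℤ, IsBddAbove X ∧ (∀ i, IsRelProjective 𝔓 (X.X i)) ∧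
    Nonempty (Y ≅ Q.obj X)

theorem relProjectiveComplexes_shift {Y : DerivedCategory C} (hY : relProjectiveComplexes 𝔓 Y)
    (n : ℤ) : relProjectiveComplexes 𝔓 (Y⟦n⟧) := by
  obtain ⟨X, ⟨N, hN⟩, hX, ⟨e⟩⟩ := hY
  exact ⟨X⟦n⟧, ⟨N - n, fun i hi => hN (i + n) (by omega)⟩, fun i => hX (i + n),
    ⟨(shiftFunctor _ n).mapIso e ≪≫ ((Q.commShiftIso n).app X).symm⟩⟩

theorem rightOrthogonal_homologyFunctor_obj_Q_iff (K : CochainComplex C ℤ) (n : ℤ) :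
    𝔓.rightOrthogonal ((homologyFunctor C n).obj (Q.obj K)) ↔
      𝔓.rightOrthogonal (K.homology n) := by
  let e : (homologyFunctor C n).obj (Q.obj K) ≅ K.homology n :=
    (homologyFunctorFactors C n).app K
  constructor
  · intro h P f hP
    rw [← cancel_mono e.inv, h (f ≫ e.inv) hP, zero_comp]
  · intro h P f hP
    rw [← cancel_mono e.hom, h (f ≫ e.hom) hP, zero_comp]

theorem homologyIn_ofComplex (h𝔓 : ∀ P : C, 𝔓 P → Projective P) {K : CochainComplex C ℤ}
    (hK : IsBddAbove K) (hK' : ∀ P : C, 𝔓 P → HomExact P K) :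
    homologyIn 𝔓.rightOrthogonal (ofComplex K hK) :=
  fun n => (rightOrthogonal_homologyFunctor_obj_Q_iff K n).2
    (rightOrthogonal_homology_of_homExact h𝔓 hK' n)

theorem hom_eq_zero_of_relProjectiveComplexes (h𝔓 : ∀ P : C, 𝔓 P → Projective P)
    {Y L : DerivedCategory C} (hY : relProjectiveComplexes 𝔓 Y)
    (hL : ∀ n : ℤ, 𝔓.rightOrthogonal ((homologyFunctor C n).obj L)) (g : Y ⟶ L) : g = 0 := by
  obtain ⟨X, hX, hX', ⟨e⟩⟩ := hY
  have hE := Q.objObjPreimageIso L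
  generalize Q.objPreimage L = K at hE
  have hK (P : C) (hP : 𝔓 P) : HomExact P K :=
    homExact_of_rightOrthogonal_homology h𝔓 (fun i => by
      rw [← rightOrthogonal_homologyFunctor_obj_Q_iff]
      intro P f hP
      rw [← cancel_mono ((homologyFunctor C i).map hE.hom), zero_comp]
      exact hL i _ hP) hP
  have : X.IsKProjective := by
    obtain ⟨N, hN⟩ := hX
    have := (CochainComplex.isStrictlyLE_iff X N).2 hN
    have (i : ℤ) : Projective (X.X i) := (hX' i).projective h𝔓
    exact CochainComplex.isKProjective_of_projective X N
  obtain ⟨f, hf⟩ := Q_map_surjective_of_isKProjective X K (e.inv ≫ g ≫ hE.inv)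
  obtain ⟨h⟩ := nonempty_homotopy_zero hX hX' hK f
  dsimp only at hf
  rw [Q_map_eq_of_homotopy C h, Functor.map_zero] at hf
  rw [← cancel_mono hE.inv, ← cancel_epi e.inv, ← hf, zero_comp, comp_zero]

open Pretriangulated in
-- In the long exact sequence of `Hom(-, L)`, the vanishing on `T.obj₃` gives injectivity and that
-- on `T.obj₃⟦-1⟧` gives surjectivity.
theorem bijective_mor₁_comp {D : Type*} [Category* D] [Preadditive D] [HasZeroObject D]
    [HasShift D ℤ] [∀ n : ℤ, (shiftFunctor D n).Additive] [Pretriangulated D]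
    {T : Triangle D} (hT : T ∈ distTriang D) {L : D} (h : ∀ g : T.obj₃ ⟶ L, g = 0)
    (h' : ∀ g : T.obj₃⟦(-1 : ℤ)⟧ ⟶ L, g = 0) :
    Function.Bijective (fun g : T.obj₂ ⟶ L => T.mor₁ ≫ g) := by
  constructor
  · intro g₁ g₂ hg
    obtain ⟨a, ha⟩ := T.yoneda_exact₂ hT (g₁ - g₂) (by
      rw [Preadditive.comp_sub, sub_eq_zero]; exact hg)
    rw [h a, comp_zero, sub_eq_zero] at ha
    exact ha
  · intro g
    obtain ⟨a, ha⟩ := Triangle.yoneda_exact₂ _ (inv_rot_of_distTriang _ hT) g (h' _)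
    exact ⟨a, ha.symm⟩

/-- `η : K ⟶ M` exhibits `M` as the universal object of `D⁻_B(C)` under `K`. -/
def IsReflection {B : ObjectProperty C} {K : DerivedCategory.Minus C} (M : DMinus B)
    (η : K ⟶ (jLower B).obj M) : Prop :=
  ∀ L : DMinus B, Function.Bijective (fun g : M ⟶ L => η ≫ (jLower B).map g)

open Pretriangulated in
theorem isReflection_of_triangle (h𝔓 : ∀ P : C, 𝔓 P → Projective P)
    {K : DerivedCategory.Minus C} {M : DMinus 𝔓.rightOrthogonal}
    (η : K ⟶ (jLower 𝔓.rightOrthogonal).obj M) {Y : DerivedCategory C} (v : M.obj.obj ⟶ Y)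
    (w : Y ⟶ K.obj⟦(1 : ℤ)⟧) (hT : Triangle.mk η.hom v w ∈ distTriang (DerivedCategory C))
    (hY : relProjectiveComplexes 𝔓 Y) : IsReflection M η := by
  intro L
  obtain ⟨h₁, h₂⟩ := bijective_mor₁_comp hT (L := L.obj.obj)
    (hom_eq_zero_of_relProjectiveComplexes h𝔓 hY L.property)
    (hom_eq_zero_of_relProjectiveComplexes h𝔓 (relProjectiveComplexes_shift hY _) L.property)
  constructor
  · intro g g' hg
    ext
    exact h₁ (congrArg InducedCategory.Hom.hom hg)
  · intro g
    obtain ⟨a, ha⟩ := h₂ g.hom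
    exact ⟨ObjectProperty.homMk (ObjectProperty.homMk a), by ext; exact ha⟩

end

/-! ### The functor `j^*`, its computation by resolutions, and the towers. -/

section

open DerivedCategory Pretriangulated

variable {C : Type u} [Category.{v} C] [Abelian C]
  {𝔓 : ObjectProperty C}

instance Resolution.mono_inc {A : C} (R : Resolution 𝔓 A) : Mono R.inc := by
  have (i : ℤ) : Mono (R.inc.f i) := by
    obtain rfl | hi := eq_or_ne i 0
    · have := R.isIso_inc
      infer_instance
    · have : IsZero ((stalk A).X i) := HomologicalComplex.isZero_single_obj_X _ _ _ _ hi
      exact ⟨fun _ _ _ => this.eq_of_tgt _ _⟩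
  exact HomologicalComplex.mono_of_mono_f _ this

theorem Resolution.shortExact {A : C} (R : Resolution 𝔓 A) :
    (ShortComplex.mk R.inc (cokernel.π R.inc) (cokernel.condition _)).ShortExact where
  exact := ShortComplex.exact_cokernel _

/-- Dividing out `A` removes the degree `0` term and leaves the `𝔓`-projective terms in negative
degrees. The quotient is thus the third vertex required by `isReflection_of_triangle`. -/
theorem Resolution.isRelProjective_cokernel_inc {A : C} (R : Resolution 𝔓 A) (i : ℤ) :
    IsRelProjective 𝔓 ((cokernel R.inc).X i) ∧ (0 < i → IsZero ((cokernel R.inc).X i)) := by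
  have h := R.shortExact.map_of_exact (HomologicalComplex.eval C (ComplexShape.up ℤ) i)
  have hA (hi : i ≠ 0) : IsZero ((stalk A).X i) :=
    HomologicalComplex.isZero_single_obj_X _ _ _ _ hi
  have h₀ (hi : 0 ≤ i) : IsZero ((cokernel R.inc).X i) := by
    obtain rfl | hi := hi.eq_or_lt
    · exact h.isIso_f_iff.1 R.isIso_inc
    · have := h.epi_g
      exact IsZero.of_epi ((cokernel.π R.inc).f i) (R.isZero_X i hi)
  refine ⟨?_, fun hi => h₀ hi.le⟩
  obtain hi | hi := lt_or_ge i 0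
  · have : IsIso ((cokernel.π R.inc).f i) := h.isIso_g_iff.2 (hA hi.ne)
    exact (R.relProjective i hi).of_iso (asIso ((cokernel.π R.inc).f i))
  · exact isRelProjective_of_isZero (h₀ hi)

variable [HasDerivedCategory.{w} C]

theorem isReflection_mappingCone (h𝔓 : ∀ P : C, 𝔓 P → Projective P) {X K : CochainComplex C ℤ}
    (p : X ⟶ K) (hp : IsComplexResolution 𝔓 p) (hK : IsBddAbove K)
    (hM : homologyIn 𝔓.rightOrthogonal (ofComplex (CochainComplex.mappingCone p)
      (isBddAbove_mappingCone p hp.bddAbove hK))) :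
    IsReflection ⟨_, hM⟩ (ofMap (CochainComplex.mappingCone.inr p) hK
      (isBddAbove_mappingCone p hp.bddAbove hK)) :=
  isReflection_of_triangle h𝔓 _ _ _
    -- Rotation puts `K → Cone p` first and makes `X[1]` the third vertex.
    (rot_of_distTriang _ (mappingCone_triangle_distinguished p))
    (relProjectiveComplexes_shift
      ⟨X, hp.bddAbove, hp.relProjective, ⟨Iso.refl _⟩⟩ 1)

theorem isReflection_resolution (h𝔓 : ∀ P : C, 𝔓 P → Projective P) {A : C} (R : Resolution 𝔓 A)
    (hM : homologyIn 𝔓.rightOrthogonal (ofComplex R.complex R.isBddAbove)) :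
    IsReflection ⟨_, hM⟩ (ofMap R.inc (isBddAbove_stalk A) R.isBddAbove) :=
  isReflection_of_triangle h𝔓 _ _ _ (triangleOfSES_distinguished R.shortExact)
    ⟨_, ⟨0, fun i => (R.isRelProjective_cokernel_inc i).2⟩,
      fun i => (R.isRelProjective_cokernel_inc i).1, ⟨Iso.refl _⟩⟩

theorem exists_ofComplex_iso (K : DerivedCategory.Minus C) :
    ∃ (L : CochainComplex C ℤ) (hL : IsBddAbove L), Nonempty (K ≅ ofComplex L hL) := by
  obtain ⟨Y, n, ⟨⟨L, e, hL⟩⟩⟩ := K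
  exact ⟨L, ⟨n, (CochainComplex.isStrictlyLE_iff L n).1 hL⟩, ⟨ObjectProperty.isoMk _ e⟩⟩

theorem IsReflection.iso_comp {B : ObjectProperty C} {K K' : DerivedCategory.Minus C}
    {M : DMinus B} {η : K ⟶ (jLower B).obj M} (h : IsReflection M η) (e : K' ≅ K) :
    IsReflection M (e.hom ≫ η) := by
  intro L
  have h' : Function.Bijective (fun g : K ⟶ (jLower B).obj L => e.hom ≫ g) :=
    (Iso.homFromEquiv e.symm).bijective
  simpa only [Category.assoc] using! h'.comp (h L)

theorem exists_isReflection [HasCoproducts.{v} C] [ObjectProperty.Small.{v} 𝔓]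
    (h𝔓 : ∀ P : C, 𝔓 P → Projective P) (K : DerivedCategory.Minus C) :
    ∃ (M : DMinus 𝔓.rightOrthogonal) (η : K ⟶ (jLower 𝔓.rightOrthogonal).obj M),
      IsReflection M η := by
  obtain ⟨L, hL, ⟨e⟩⟩ := exists_ofComplex_iso K
  obtain ⟨N, hN⟩ := hL
  obtain ⟨X, p, hp, -⟩ := exists_isComplexResolution 𝔓 L N hN
  have hM := homologyIn_ofComplex h𝔓 (isBddAbove_mappingCone p hp.bddAbove ⟨N, hN⟩) hp.homExact
  exact ⟨⟨_, hM⟩, _, (isReflection_mappingCone h𝔓 p hp ⟨N, hN⟩ hM).iso_comp e⟩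

theorem exists_leftAdjoint_jLower [HasCoproducts.{v} C] [ObjectProperty.Small.{v} 𝔓]
    (h𝔓 : ∀ P : C, 𝔓 P → Projective P) :
    ∃ jStar : DerivedCategory.Minus C ⥤ DMinus 𝔓.rightOrthogonal,
      Nonempty (jStar ⊣ jLower 𝔓.rightOrthogonal) := by
  choose M η h using exists_isReflection (C := C) h𝔓
  exact ⟨_, ⟨Adjunction.adjunctionOfEquivLeft
    (fun K L => Equiv.ofBijective _ (h K L))
    (fun K L L' g f => by simp)⟩⟩

/-- The unit of any adjunction is also a universal arrow, and two universal arrows from `K` differ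
by an isomorphism. So the resolution chosen in building `j^*` does not matter. -/
theorem IsReflection.exists_iso {B : ObjectProperty C} {jStar : DerivedCategory.Minus C ⥤ DMinus B}
    (adj : jStar ⊣ jLower B) {K : DerivedCategory.Minus C} {M : DMinus B}
    {η : K ⟶ (jLower B).obj M} (h : IsReflection M η) :
    ∃ e : jStar.obj K ≅ M, adj.unit.app K ≫ (jLower B).map e.hom = η := by
  obtain ⟨b, hb⟩ := (h (jStar.obj K)).2 (adj.unit.app K)
  dsimp only at hb
  have ha : adj.unit.app K ≫ (jLower B).map ((adj.homEquiv K M).symm η) = η :=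
    (adj.homEquiv_unit ..).symm.trans (Equiv.apply_symm_apply _ _)
  refine ⟨⟨(adj.homEquiv K M).symm η, b, ?_, ?_⟩, ha⟩
  · apply (adj.homEquiv K _).injective
    rw [adj.homEquiv_unit, adj.homEquiv_unit, Functor.map_comp, reassoc_of% ha, hb,
      CategoryTheory.Functor.map_id]
    exact (Category.comp_id _).symm
  · apply (h M).1
    dsimp only
    rw [Functor.map_comp, reassoc_of% hb, ha, CategoryTheory.Functor.map_id, Category.comp_id]

theorem exists_unique_jStar_tower (𝔓 : ℕ → ObjectProperty C) (h : ∀ n, 𝔓 (n + 1) ≤ 𝔓 n)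
    (jStar : ∀ n : ℕ, DerivedCategory.Minus C ⥤ DMinus (𝔓 n).rightOrthogonal)
    (adj : ∀ n : ℕ, jStar n ⊣ jLower (𝔓 n).rightOrthogonal) :
    ∃! σ : ∀ n : ℕ, jStar (n + 1) ⋙ jLower (𝔓 (n + 1)).rightOrthogonal ⟶
        jStar n ⋙ jLower (𝔓 n).rightOrthogonal,
      ∀ (n : ℕ) (K : DerivedCategory.Minus C),
        (adj (n + 1)).unit.app K ≫ (σ n).app K = (adj n).unit.app K := by
  -- Seen through `F n`, the values of `j_n^*` become admissible targets for the universal property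
  -- of `j_{n+1}^*`; this yields the transition maps, their naturality and their uniqueness.
  let F (n : ℕ) : DMinus (𝔓 n).rightOrthogonal ⥤ DMinus (𝔓 (n + 1)).rightOrthogonal :=
    ObjectProperty.ιOfLE fun K hK i => rightOrthogonal_antitone (h n) _ (hK i)
  have hom_ext (n : ℕ) {K : DerivedCategory.Minus C} {L : DMinus (𝔓 n).rightOrthogonal}
      {f g : (jLower (𝔓 (n + 1)).rightOrthogonal).obj ((jStar (n + 1)).obj K) ⟶
        (jLower (𝔓 n).rightOrthogonal).obj L}
      (hfg : (adj (n + 1)).unit.app K ≫ f = (adj (n + 1)).unit.app K ≫ g) : f = g := by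
    let f' : (jStar (n + 1)).obj K ⟶ (F n).obj L := ObjectProperty.homMk f
    let g' : (jStar (n + 1)).obj K ⟶ (F n).obj L := ObjectProperty.homMk g
    have : f' = g' := ((adj (n + 1)).homEquiv K _).injective (by
      rw [Adjunction.homEquiv_unit, Adjunction.homEquiv_unit]
      exact hfg)
    exact congrArg InducedCategory.Hom.hom this
  let τ (n : ℕ) (K : DerivedCategory.Minus C) : (jStar (n + 1)).obj K ⟶
      (F n).obj ((jStar n).obj K) :=
    ((adj (n + 1)).homEquiv K ((F n).obj ((jStar n).obj K))).symm ((adj n).unit.app K)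
  have hτ (n : ℕ) (K : DerivedCategory.Minus C) :
      (adj (n + 1)).unit.app K ≫ (τ n K).hom = (adj n).unit.app K :=
    ((adj (n + 1)).homEquiv_unit (f := τ n K)).symm.trans (Equiv.apply_symm_apply _ _)
  refine ⟨fun n =>
    { app := fun K => (τ n K).hom
      naturality := fun K K' f => ?_ }, hτ, fun σ hσ => ?_⟩
  · apply hom_ext n
    have h₁ := (adj (n + 1)).unit.naturality f
    have h₂ := (adj n).unit.naturality f
    dsimp at h₁ h₂ ⊢
    rw [← reassoc_of% h₁, hτ, reassoc_of% hτ, h₂]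
  · funext n
    ext K : 2
    exact hom_ext n ((hσ n K).trans (hτ n K).symm)

end

end

end RelativeProjective

theorem mainTheorem1 {C : Type u} [Category.{v} C] [Abelian C] [HasCoproducts.{v} C]
    [HasDerivedCategory.{w} C] :
    (∀ (𝔓 : ObjectProperty C) [ObjectProperty.Small.{v} 𝔓]
        (h𝔓 : ∀ P : C, 𝔓 P → Projective P),
      -- `𝔓^⊥` is a thick abelian subcategory with exact inclusion
      (𝔓.rightOrthogonal.ContainsZero ∧
        𝔓.rightOrthogonal.IsClosedUnderKernels ∧
        𝔓.rightOrthogonal.IsClosedUnderCokernels ∧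
        𝔓.rightOrthogonal.IsClosedUnderExtensions) ∧
      (∃ a : Abelian 𝔓.rightOrthogonal.FullSubcategory,
        a.toPreadditive = (inferInstance : Preadditive 𝔓.rightOrthogonal.FullSubcategory)) ∧
      PreservesFiniteLimits 𝔓.rightOrthogonal.ι ∧
      PreservesFiniteColimits 𝔓.rightOrthogonal.ι ∧
      -- `i^*` is left adjoint to `i_*`, with unit the projection onto the cokernel
      (∃ adj : iStar 𝔓 h𝔓 ⊣ 𝔓.rightOrthogonal.ι, ∀ A : C, adj.unit.app A = iUnit 𝔓 h𝔓 A) ∧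
      -- existence of resolutions, of objects and of bounded above complexes
      (∀ A : C, ∃ R : Resolution 𝔓 A, ∀ i : ℤ, i < 0 → IsCoproductOf 𝔓 (R.complex.X i)) ∧
      (∀ K : CochainComplex C ℤ, IsBddAbove K →
        ∃ (X : CochainComplex C ℤ) (p : X ⟶ K),
          IsComplexResolution 𝔓 p ∧ ∀ i : ℤ, IsCoproductOf 𝔓 (X.X i)) ∧
      -- `j^*` is left adjoint to `j_*` and is computed by resolutions
      ∃ (jStar : DerivedCategory.Minus C ⥤ DMinus 𝔓.rightOrthogonal)
        (adj : jStar ⊣ jLower 𝔓.rightOrthogonal),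
        (∀ (A : C) (R : Resolution 𝔓 A),
          ∃ (h : homologyIn 𝔓.rightOrthogonal (ofComplex R.complex R.isBddAbove))
            (e : jStar.obj (ofComplex (stalk A) (isBddAbove_stalk A)) ≅ ⟨_, h⟩),
            adj.unit.app _ ≫ (jLower 𝔓.rightOrthogonal).map e.hom =
              ofMap R.inc (isBddAbove_stalk A) R.isBddAbove) ∧
        (∀ (X K : CochainComplex C ℤ) (p : X ⟶ K) (hp : IsComplexResolution 𝔓 p)
            (hK : IsBddAbove K),
          ∃ (h : homologyIn 𝔓.rightOrthogonal
              (ofComplex (CochainComplex.mappingCone p)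
                (isBddAbove_mappingCone p hp.bddAbove hK)))
            (e : jStar.obj (ofComplex K hK) ≅ ⟨_, h⟩),
            adj.unit.app _ ≫ (jLower 𝔓.rightOrthogonal).map e.hom =
              ofMap (CochainComplex.mappingCone.inr p) hK
                (isBddAbove_mappingCone p hp.bddAbove hK))) ∧
    -- the towers attached to a descending chain
    (∀ (𝔓 : ℕ → ObjectProperty C) [∀ n, ObjectProperty.Small.{v} (𝔓 n)]
        (h𝔓 : ∀ (n : ℕ) (P : C), 𝔓 n P → Projective P),
      (∀ n, 𝔓 (n + 1) ≤ 𝔓 n) →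
      (∀ n, (𝔓 n).rightOrthogonal ≤ (𝔓 (n + 1)).rightOrthogonal) ∧
      (∀ (n : ℕ) (A : C), Epi (iUnit (𝔓 n) (h𝔓 n) A)) ∧
      (∃! τ : ∀ n : ℕ, iStar (𝔓 (n + 1)) (h𝔓 (n + 1)) ⋙ (𝔓 (n + 1)).rightOrthogonal.ι ⟶
          iStar (𝔓 n) (h𝔓 n) ⋙ (𝔓 n).rightOrthogonal.ι,
        ∀ (n : ℕ) (A : C),
          iUnit (𝔓 (n + 1)) (h𝔓 (n + 1)) A ≫ (τ n).app A = iUnit (𝔓 n) (h𝔓 n) A ∧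
            Epi ((τ n).app A)) ∧
      ∀ (jStar : ∀ n : ℕ, DerivedCategory.Minus C ⥤ DMinus (𝔓 n).rightOrthogonal)
        (adj : ∀ n : ℕ, jStar n ⊣ jLower (𝔓 n).rightOrthogonal),
        ∃! σ : ∀ n : ℕ, jStar (n + 1) ⋙ jLower (𝔓 (n + 1)).rightOrthogonal ⟶
            jStar n ⋙ jLower (𝔓 n).rightOrthogonal,
          ∀ (n : ℕ) (K : DerivedCategory.Minus C),
            (adj (n + 1)).unit.app K ≫ (σ n).app K = (adj n).unit.app K) := by
  refine ⟨fun 𝔓 _ h𝔓 => ?_, fun 𝔓 _ h𝔓 h => ?_⟩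
  · obtain ⟨h₁, h₂, h₃⟩ := rightOrthogonal_exists_abelian h𝔓
    obtain ⟨jStar, ⟨adj⟩⟩ := exists_leftAdjoint_jLower (C := C) h𝔓
    refine ⟨⟨rightOrthogonal_containsZero 𝔓, rightOrthogonal_isClosedUnderKernels 𝔓,
      rightOrthogonal_isClosedUnderCokernels h𝔓, rightOrthogonal_isClosedUnderExtensions 𝔓⟩,
      h₁, h₂, h₃, exists_iStar_adjunction 𝔓 h𝔓, exists_resolution 𝔓, fun K ⟨N, hN⟩ => ?_,
      jStar, adj, fun A R => ?_, fun X K p hp hK => ?_⟩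
    · obtain ⟨X, p, hp, hX, -⟩ := exists_isComplexResolution 𝔓 K N hN
      exact ⟨X, p, hp, hX⟩
    · have hR := homologyIn_ofComplex h𝔓 R.isBddAbove R.homExact
      exact ⟨hR, (isReflection_resolution h𝔓 R hR).exists_iso adj⟩
    · have hM := homologyIn_ofComplex h𝔓 (isBddAbove_mappingCone p hp.bddAbove hK) hp.homExact
      exact ⟨hM, (isReflection_mappingCone h𝔓 p hp hK hM).exists_iso adj⟩
  · exact ⟨fun n => rightOrthogonal_antitone (h n), fun n A => epi_iUnit (𝔓 n) (h𝔓 n) A,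
      exists_unique_iStar_tower 𝔓 h𝔓 h, exists_unique_jStar_tower 𝔓 h⟩
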